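/- Let $\Delta=\{z\in\mathbb C:|z|<1\}$. There is a universal constant $L\ge 0$ with the following property. Let $f$ be a holomorphic function on $\Delta$ that omits the values $0$ and $1$, and let $M$ be a real number with $|f(0)|<M$. Then for every $r\in(0,1)$ and every $z$ with $|z|<r$, $$\arctan|f(z)|<\arctan M+\frac{2rL}{1-r^2},$$ and hence $$|f(z)|<\tan\Bigl(\arctan M+\frac{2rL}{1-r^2}\Bigr)\qquad\text{whenever}\quad \arctan M+\frac{2rL}{1-r^2}<\frac{\pi}{2}.$$ (In other words, the bound $|f(z)|<\tan\theta$ with $\theta=\arctan M+2rL/(1-r^2)$ holds for every $r\in(0,1)$ and $|z|<r$, where $\tan\theta$ is read as $+\infty$ when $\theta\ge\pi/2$.) The constant $L$ does not depend on $f$, $M$, $r$ or $z$. -/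

import Mathlib

open Complex Metric Set

/-! The point is Landau's theorem in spherical form: if `f` omits 0 and 1, then |f'|/(1 + |f|²) at
the centre is bounded by an absolute constant. Write f = exp(2πi cosh² H). Since f ≠ 1, `H` avoids
every point where cosh² is a natural number, and these points meet every disc of radius 3. Bloch's
theorem then bounds |H'(0)|, and the chain rule bounds f'(0). Rescaling moves the estimate to any
point of the disc. As |f'|/(1 + |f|²) dominates the rate of change of arctan |f|, integrating along
a radius gives the claim. -/

/-! ### Bloch's theorem -/

/-- A weak form of **Bloch's theorem**. -/
theorem exists_ball_subset_image_of_deriv_ne_zero {g : ℂ → ℂ}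
    (hg : DifferentiableOn ℂ g (ball 0 1)) (h0 : deriv g 0 ≠ 0) :
    ∃ c, ball c (‖deriv g 0‖ / 128) ⊆ g '' ball 0 1 := by
  have hd : DifferentiableOn ℂ (deriv g) (ball 0 1) := hg.deriv isOpen_ball
  have hsub : closedBall (0 : ℂ) (1 / 2) ⊆ ball 0 1 := closedBall_subset_ball (by norm_num)
  obtain ⟨a, ha, hmax⟩ := (isCompact_closedBall (0 : ℂ) (1 / 2)).exists_isMaxOn
    ⟨0, by simp⟩ (f := fun z ↦ ‖deriv g z‖ * (1 / 2 - ‖z‖))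
    ((hd.continuousOn.mono hsub).norm.mul (by fun_prop))
  have hpos : 0 < ‖deriv g 0‖ := norm_pos_iff.2 h0
  have h0a : ‖deriv g 0‖ * (1 / 2) ≤ ‖deriv g a‖ * (1 / 2 - ‖a‖) := by
    simpa using hmax (show (0 : ℂ) ∈ closedBall (0 : ℂ) (1 / 2) by simp)
  have ha' : ‖a‖ ≤ 1 / 2 := by simpa using ha
  set D := ‖deriv g a‖ with hD
  have hDpos : 0 < D := by
    rcases (norm_nonneg (deriv g a)).eq_or_lt with h | h
    · rw [← hD] at h; rw [← h] at h0a; linarith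
    · exact h
  -- With half the distance to the circle |z| = 1/2 as radius, maximality of `a` gives |g'| ≤ 2D on
  -- `ball a t`.
  obtain ⟨t, ht⟩ : ∃ t, t = (1 / 2 - ‖a‖) / 2 := ⟨_, rfl⟩
  have htpos : 0 < t := by
    by_contra hneg
    have : D * (1 / 2 - ‖a‖) ≤ 0 := mul_nonpos_of_nonneg_of_nonpos hDpos.le (by linarith)
    linarith
  have hDt : ‖deriv g 0‖ / 4 ≤ D * t := by rw [ht]; linarith
  have hball : ball a t ⊆ closedBall 0 (1 / 2) := by
    intro z hz
    have h1 := norm_sub_norm_le z a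
    rw [mem_ball, dist_eq_norm] at hz
    rw [mem_closedBall_zero_iff]
    linarith
  have hmaps : MapsTo (deriv g) (ball a t) (closedBall (deriv g a) (3 * D)) := by
    intro z hz
    have h2 : ‖deriv g z‖ * (1 / 2 - ‖z‖) ≤ D * (1 / 2 - ‖a‖) := hmax (hball hz)
    have h1 := norm_sub_norm_le z a
    rw [mem_ball, dist_eq_norm] at hz
    have h3 : ‖deriv g z‖ * t ≤ ‖deriv g z‖ * (1 / 2 - ‖z‖) := by gcongr; linarith
    have h4 : ‖deriv g z‖ * t ≤ (2 * D) * t := by rw [ht] at h3 ⊢; linarith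
    have h5 := le_of_mul_le_mul_right h4 htpos
    rw [mem_closedBall, dist_eq_norm]
    linarith [norm_sub_le (deriv g z) (deriv g a)]
  have hs_sub : closedBall a (t / 8) ⊆ ball a t := closedBall_subset_ball (by linarith)
  have hs_sub' : closedBall a (t / 8) ⊆ ball 0 1 := hs_sub.trans (hball.trans hsub)
  have hderiv : ∀ z ∈ closedBall a (t / 8), ‖deriv g z - deriv g a‖ ≤ 3 * D / 8 := by
    intro z hz
    have h1 := dist_le_div_mul_dist_of_mapsTo_ball (hd.mono (hball.trans hsub)) hmaps (hs_sub hz)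
    rw [mem_closedBall] at hz
    rw [← dist_eq_norm]
    calc _ ≤ 3 * D / t * dist z a := h1
      _ ≤ 3 * D / t * (t / 8) := by gcongr
      _ = 3 * D / 8 := by field_simp
  -- The linear part contributes Dt/8 and the error is at most (3D/8)(t/8).
  have hsphere : ∀ z ∈ sphere a (t / 8), 5 * D * t / 64 ≤ ‖g z - g a‖ := by
    intro z hz
    have h1 := (convex_closedBall a (t / 8)).norm_image_sub_le_of_norm_hasDerivWithin_le
      (f := fun z ↦ g z - deriv g a * z) (f' := fun z ↦ deriv g z - deriv g a) (C := 3 * D / 8)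
      (x := a) (y := z)
      (fun w hw ↦ by
        have := (hg.differentiableAt (isOpen_ball.mem_nhds (hs_sub' hw))).hasDerivAt
        exact (this.sub (by simpa using (hasDerivAt_id w).const_mul (deriv g a))).hasDerivWithinAt)
      hderiv (mem_closedBall_self (by linarith)) (sphere_subset_closedBall hz)
    rw [mem_sphere, dist_eq_norm] at hz
    rw [hz] at h1
    have h2 : ‖deriv g a * (z - a)‖ = D * (t / 8) := by rw [norm_mul, hz]
    have h3 : deriv g a * (z - a) =
      (g z - g a) - (g z - deriv g a * z - (g a - deriv g a * a)) := by ring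
    have h4 := norm_sub_le (g z - g a) (g z - deriv g a * z - (g a - deriv g a * a))
    rw [← h3, h2] at h4
    linarith
  have hfreq : ∃ᶠ z in nhds a, g z ≠ g a := by
    intro hev
    have : g =ᶠ[nhds a] fun _ ↦ g a := by
      filter_upwards [hev] with z hz using not_not.1 hz
    have h := this.deriv_eq
    rw [deriv_const] at h
    rw [hD, h, norm_zero] at hDpos
    exact lt_irrefl _ hDpos
  have hres := DiffContOnCl.ball_subset_image_closedBall
    ((hg.mono hs_sub').diffContOnCl_ball subset_rfl) (by linarith) hsphere hfreq
  exact ⟨g a, (ball_subset_ball (by linarith)).trans (hres.trans (image_mono hs_sub'))⟩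

/-! ### The net of points where cosh² is a natural number -/

/-- A real number lies within distance `1` of a point where `cosh ^ 2` is a positive integer. -/
theorem Real.exists_cosh_sq_eq_natCast (x : ℝ) :
    ∃ y : ℝ, |x - y| < 1 ∧ ∃ n : ℕ, Real.cosh y ^ 2 = n := by
  wlog hx : 0 ≤ x generalizing x
  · obtain ⟨y, hy, n, hn⟩ := this (-x) (by linarith)
    refine ⟨-y, ?_, n, by rwa [Real.cosh_neg]⟩
    rw [← abs_neg]
    convert hy using 2
    ring
  set n := ⌊Real.sinh x ^ 2⌋₊ with hn
  have hnle : (n : ℝ) ≤ Real.sinh x ^ 2 := Nat.floor_le (sq_nonneg _)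
  have hnlt : Real.sinh x ^ 2 < n + 1 := Nat.lt_floor_add_one _
  have hsx : 0 ≤ Real.sinh x := Real.sinh_nonneg_iff.2 hx
  obtain ⟨s, hs⟩ : ∃ s, s = Real.arsinh (√n) := ⟨_, rfl⟩
  have hsinh : Real.sinh s = √n := by rw [hs, Real.sinh_arsinh]
  have hsq : Real.sinh s ^ 2 = n := by rw [hsinh, Real.sq_sqrt (Nat.cast_nonneg _)]
  have hsnonneg : 0 ≤ Real.sinh s := by rw [hsinh]; positivity
  have hsx' : s ≤ x := by
    rw [← Real.sinh_le_sinh]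
    exact (sq_le_sq₀ hsnonneg hsx).1 (hsq ▸ hnle)
  refine ⟨s, ?_, n + 1, by rw [Real.cosh_sq, hsq]; push_cast; rfl⟩
  rw [abs_of_nonneg (by linarith)]
  -- A gap of 1 would force sinh x ≥ sinh s + 1, hence sinh² x ≥ n + 1, against the choice of `n`.
  by_contra! hcon
  have h1 : Real.sinh (s + 1) ≤ Real.sinh x := Real.sinh_le_sinh.2 (by linarith)
  rw [Real.sinh_add] at h1
  have hs1 : 1 ≤ Real.sinh 1 := Real.self_le_sinh_iff.2 zero_le_one
  have hc1 : 1 ≤ Real.cosh 1 := Real.one_le_cosh 1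
  have hcs := Real.one_le_cosh s
  have h2 : Real.sinh s + 1 * 1 ≤ Real.sinh s * Real.cosh 1 + Real.cosh s * Real.sinh 1 := by
    gcongr
    exact le_mul_of_one_le_right hsnonneg hc1
  nlinarith

/-- Every ball of radius `3` contains a point where `cosh ^ 2` is a positive integer. -/
theorem Complex.exists_mem_ball_cosh_sq_eq_natCast (c : ℂ) :
    ∃ w ∈ ball c 3, ∃ n : ℕ, Complex.cosh w ^ 2 = n := by
  obtain ⟨y, hy, n, hn⟩ := Real.exists_cosh_sq_eq_natCast c.re
  set m := round (c.im / Real.pi)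
  refine ⟨y + (m * Real.pi : ℝ) * I, ?_, n, ?_⟩
  · rw [mem_ball, dist_comm, dist_eq_norm]
    refine (norm_le_abs_re_add_abs_im _).trans_lt ?_
    have h1 : |c.im / Real.pi - m| ≤ 1 / 2 := abs_sub_round _
    have h2 : c.im - m * Real.pi = (c.im / Real.pi - m) * Real.pi := by
      field_simp [Real.pi_ne_zero]
    have h3 : |c.im - m * Real.pi| < 2 := by
      rw [h2, abs_mul, abs_of_pos Real.pi_pos]
      nlinarith [Real.pi_lt_four, Real.pi_pos]
    simp only [sub_re, add_re, ofReal_re, mul_re, I_re, I_im, ofReal_im, sub_im, add_im, mul_im]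
    ring_nf at hy h3 ⊢
    linarith
  · have hcos : Complex.cos ((m * Real.pi : ℝ) : ℂ) ^ 2 = 1 := by
      rw [← ofReal_cos, ← ofReal_pow, Real.cos_int_mul_pi, ← zpow_natCast, ← zpow_mul, mul_comm,
        zpow_mul]
      simp
    have hsin : Complex.sin ((m * Real.pi : ℝ) : ℂ) = 0 := by
      rw [← ofReal_sin, Real.sin_int_mul_pi, ofReal_zero]
    rw [Complex.cosh_add, Complex.cosh_mul_I, Complex.sinh_mul_I, hsin]
    rw [zero_mul, mul_zero, add_zero, mul_pow, hcos, mul_one]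
    exact_mod_cast congrArg ((↑) : ℝ → ℂ) hn

/-! ### Holomorphic logarithms, square roots and inverse cosh² -/

/-- A holomorphic logarithm on a ball with the principal value at the centre. -/
theorem DifferentiableOn.exists_exp_eq_of_forall_ne_zero {f : ℂ → ℂ} {c : ℂ} {r : ℝ} (hr : 0 < r)
    (hf : DifferentiableOn ℂ f (ball c r)) (h0 : ∀ z ∈ ball c r, f z ≠ 0) :
    ∃ g : ℂ → ℂ, DifferentiableOn ℂ g (ball c r) ∧ g c = Complex.log (f c) ∧
      ∀ z ∈ ball c r, Complex.exp (g z) = f z := by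
  have hc : c ∈ ball c r := mem_ball_self hr
  obtain ⟨g, hgc, hg⟩ :=
    (((hf.deriv isOpen_ball).div hf h0).isExactOn_ball).with_val_at c (Complex.log (f c))
  refine ⟨g, fun z hz ↦ (hg z hz).differentiableAt.differentiableWithinAt, hgc, fun z hz ↦ ?_⟩
  have hderiv : ∀ w ∈ ball c r, HasDerivAt (fun w ↦ f w * Complex.exp (-g w)) 0 w := by
    intro w hw
    have h1 := (hf.differentiableAt (isOpen_ball.mem_nhds hw)).hasDerivAt
    have h2 := h0 w hw
    refine (h1.mul (hg w hw).neg.cexp).congr_deriv ?_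
    rw [Pi.div_apply]
    field_simp
    ring
  have hconst := isOpen_ball.is_const_of_deriv_eq_zero (convex_ball c r).isPreconnected
    (fun w hw ↦ (hderiv w hw).differentiableAt.differentiableWithinAt)
    (fun w hw ↦ (hderiv w hw).deriv) hz hc
  simp only [hgc, Complex.exp_neg, Complex.exp_log (h0 c hc)] at hconst
  rw [mul_inv_cancel₀ (h0 c hc), ← div_eq_mul_inv, div_eq_one_iff_eq (Complex.exp_ne_zero _)]
    at hconst
  exact hconst.symm

theorem DifferentiableOn.exists_sq_eq_of_forall_ne_zero {f : ℂ → ℂ} {c : ℂ} {r : ℝ} (hr : 0 < r)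
    (hf : DifferentiableOn ℂ f (ball c r)) (h0 : ∀ z ∈ ball c r, f z ≠ 0) :
    ∃ g : ℂ → ℂ, DifferentiableOn ℂ g (ball c r) ∧ ∀ z ∈ ball c r, g z ^ 2 = f z := by
  obtain ⟨g, hg, -, hexp⟩ := hf.exists_exp_eq_of_forall_ne_zero hr h0
  refine ⟨fun z ↦ Complex.exp (g z / 2), (hg.div_const 2).cexp, fun z hz ↦ ?_⟩
  rw [← hexp z hz, ← Complex.exp_nat_mul]
  congr 1
  push_cast
  ring

/-- A holomorphic function without the values `0` and `1` is of the form `cosh ^ 2`. -/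
theorem DifferentiableOn.exists_cosh_sq_eq {F : ℂ → ℂ} {c : ℂ} {r : ℝ} (hr : 0 < r)
    (hF : DifferentiableOn ℂ F (ball c r)) (h01 : ∀ z ∈ ball c r, F z ≠ 0 ∧ F z ≠ 1) :
    ∃ H : ℂ → ℂ, DifferentiableOn ℂ H (ball c r) ∧
      ∀ z ∈ ball c r, Complex.cosh (H z) ^ 2 = F z := by
  obtain ⟨A, hA, hA2⟩ := hF.exists_sq_eq_of_forall_ne_zero hr fun z hz ↦ (h01 z hz).1
  obtain ⟨B, hB, hB2⟩ := (hF.sub_const 1).exists_sq_eq_of_forall_ne_zero hr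
    fun z hz ↦ sub_ne_zero.2 (h01 z hz).2
  -- With A² = F and B² = F - 1, a logarithm `H` of A - B has exp(-H) = A + B, so cosh H = A.
  have hmul : ∀ z ∈ ball c r, (A z - B z) * (A z + B z) = 1 := fun z hz ↦ by
    linear_combination hA2 z hz - hB2 z hz
  obtain ⟨H, hH, -, hexp⟩ := (hA.sub hB).exists_exp_eq_of_forall_ne_zero hr
    fun z hz ↦ left_ne_zero_of_mul_eq_one (hmul z hz)
  refine ⟨H, hH, fun z hz ↦ ?_⟩
  have h1 : Complex.exp (H z) = A z - B z := hexp z hz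
  have h2 : Complex.exp (-H z) = A z + B z := by
    rw [Complex.exp_neg, h1]
    exact inv_eq_of_mul_eq_one_right (hmul z hz)
  rw [Complex.cosh, h1, h2, ← hA2 z hz]
  ring

/-! ### Landau's theorem -/

/-- Here 384 = 3 · 128: a larger derivative would put a disc of radius 3 in the image of `H`. -/
theorem norm_deriv_le_of_forall_cosh_sq_ne_natCast {H : ℂ → ℂ}
    (hH : DifferentiableOn ℂ H (ball 0 1))
    (hne : ∀ z ∈ ball (0 : ℂ) 1, ∀ n : ℕ, Complex.cosh (H z) ^ 2 ≠ n) : ‖deriv H 0‖ ≤ 384 := by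
  by_contra! hcon
  obtain ⟨c, hc⟩ := exists_ball_subset_image_of_deriv_ne_zero hH
    (norm_pos_iff.1 (by linarith))
  obtain ⟨w, hw, n, hn⟩ := Complex.exists_mem_ball_cosh_sq_eq_natCast c
  obtain ⟨z, hz, rfl⟩ := hc (ball_subset_ball (by linarith) hw)
  exact hne z hz n hn

/-- Absorbs the logarithm of |f(0)| into the spherical weight, for small and large values alike. -/
theorem Real.mul_abs_log_le_one_add_sq {x : ℝ} (hx : 0 < x) :
    x * |Real.log x| ≤ 1 + x ^ 2 := by
  rcases le_total 1 x with h | h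
  · rw [abs_of_nonneg (Real.log_nonneg h)]
    nlinarith [Real.log_le_sub_one_of_pos hx]
  · rw [abs_of_nonpos (Real.log_nonpos hx.le h), ← Real.log_inv]
    have h1 := mul_le_mul_of_nonneg_left (Real.log_le_sub_one_of_pos (inv_pos.2 hx)) hx.le
    rw [mul_sub, mul_inv_cancel₀ hx.ne'] at h1
    nlinarith

/-- **Landau's theorem** for the unit disc, as a bound on the spherical derivative at `0`. -/
theorem norm_deriv_zero_le_of_omits_zero_one {f : ℂ → ℂ} (hf : DifferentiableOn ℂ f (ball 0 1))
    (h01 : ∀ z ∈ ball (0 : ℂ) 1, f z ≠ 0 ∧ f z ≠ 1) :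
    ‖deriv f 0‖ ≤ 3840 * (1 + ‖f 0‖ ^ 2) := by
  have h0 : (0 : ℂ) ∈ ball (0 : ℂ) 1 := mem_ball_self one_pos
  obtain ⟨g, hg, hg0, hexp⟩ := hf.exists_exp_eq_of_forall_ne_zero one_pos fun z hz ↦ (h01 z hz).1
  have hpi : (2 * Real.pi * I : ℂ) ≠ 0 := two_pi_I_ne_zero
  have hint : ∀ z ∈ ball (0 : ℂ) 1, ∀ n : ℤ, g z / (2 * Real.pi * I) ≠ n := by
    intro z hz n hn
    rw [div_eq_iff hpi] at hn
    apply (h01 z hz).2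
    rw [← hexp z hz, hn, exp_int_mul_two_pi_mul_I]
  obtain ⟨H, hH, hcosh⟩ := (hg.div_const (2 * Real.pi * I)).exists_cosh_sq_eq one_pos
    fun z hz ↦ ⟨by simpa using hint z hz 0, by simpa using hint z hz 1⟩
  have hH0 : ‖deriv H 0‖ ≤ 384 := norm_deriv_le_of_forall_cosh_sq_ne_natCast hH
    fun z hz n ↦ by rw [hcosh z hz]; exact_mod_cast hint z hz n
  have hHd := (hH.differentiableAt (isOpen_ball.mem_nhds h0)).hasDerivAt
  have hfH : f =ᶠ[nhds 0] fun z ↦ Complex.exp (2 * Real.pi * I * Complex.cosh (H z) ^ 2) := by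
    filter_upwards [isOpen_ball.mem_nhds h0] with z hz
    rw [hcosh z hz, mul_div_cancel₀ _ hpi, hexp z hz]
  have hderiv : deriv f 0 = f 0 * (2 * Real.pi * I *
      (2 * Complex.cosh (H 0) * (Complex.sinh (H 0) * deriv H 0))) := by
    rw [hfH.deriv_eq, hfH.self_of_nhds]
    have := ((hHd.ccosh.pow 2).const_mul (2 * Real.pi * I : ℂ)).cexp.deriv
    simpa using this
  set x := ‖f 0‖ with hx
  have hxpos : 0 < x := norm_pos_iff.2 (h01 0 h0).1
  -- The principal value of the logarithm at 0 keeps its imaginary part within π.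
  have hF0 : 2 * Real.pi * ‖Complex.cosh (H 0)‖ ^ 2 ≤ |Real.log x| + Real.pi := by
    rw [← norm_pow, hcosh 0 h0, hg0, norm_div]
    have h1 : ‖(2 * Real.pi * I : ℂ)‖ = 2 * Real.pi := by
      simp [abs_of_pos Real.pi_pos]
    rw [h1, mul_div_cancel₀ _ (by positivity)]
    refine (norm_le_abs_re_add_abs_im _).trans ?_
    rw [log_re, log_im]
    gcongr
    exact abs_arg_le_pi _
  have hsinh : ‖Complex.sinh (H 0)‖ ^ 2 ≤ ‖Complex.cosh (H 0)‖ ^ 2 + 1 := by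
    rw [← norm_pow, ← norm_pow, Complex.sinh_sq]
    simpa only [norm_one] using norm_sub_le (Complex.cosh (H 0) ^ 2) 1
  have hprod : 2 * (‖Complex.cosh (H 0)‖ * ‖Complex.sinh (H 0)‖) ≤
      2 * ‖Complex.cosh (H 0)‖ ^ 2 + 1 := by
    nlinarith [sq_nonneg (‖Complex.cosh (H 0)‖ - ‖Complex.sinh (H 0)‖)]
  have hxlog := Real.mul_abs_log_le_one_add_sq hxpos
  have hpi4 := Real.pi_lt_four
  calc ‖deriv f 0‖
      = x * (2 * Real.pi) * (2 * (‖Complex.cosh (H 0)‖ * ‖Complex.sinh (H 0)‖)) * ‖deriv H 0‖ := by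
        rw [hderiv]
        simp only [norm_mul, norm_I, Complex.norm_real, Complex.norm_ofNat, Real.norm_eq_abs,
          abs_of_pos Real.pi_pos, ← hx]
        ring
    _ ≤ x * (2 * Real.pi) * (2 * ‖Complex.cosh (H 0)‖ ^ 2 + 1) * 384 := by gcongr
    _ = 384 * x * (2 * (2 * Real.pi * ‖Complex.cosh (H 0)‖ ^ 2) + 2 * Real.pi) := by ring
    _ ≤ 384 * x * (2 * (|Real.log x| + Real.pi) + 2 * Real.pi) := by gcongr
    _ = 768 * (x * |Real.log x|) + 768 * Real.pi * (2 * x) := by ring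
    _ ≤ 768 * (1 + x ^ 2) + 768 * 4 * (1 + x ^ 2) := by
        gcongr
        nlinarith [sq_nonneg (x - 1)]
    _ = 3840 * (1 + x ^ 2) := by ring

/-! ### Integration along radii -/

/-- Landau's bound applied to w ↦ f(a + (1 - |a|)w). -/
theorem norm_deriv_le_of_omits_zero_one {f : ℂ → ℂ} (hf : DifferentiableOn ℂ f (ball 0 1))
    (h01 : ∀ z ∈ ball (0 : ℂ) 1, f z ≠ 0 ∧ f z ≠ 1) {a : ℂ} (ha : ‖a‖ < 1) :
    ‖deriv f a‖ * (1 - ‖a‖) ≤ 3840 * (1 + ‖f a‖ ^ 2) := by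
  have hs : 0 < 1 - ‖a‖ := by linarith
  have hmaps : MapsTo (fun w : ℂ ↦ a + (1 - ‖a‖ : ℝ) * w) (ball 0 1) (ball 0 1) := by
    intro w hw
    rw [mem_ball_zero_iff] at hw ⊢
    calc ‖a + (1 - ‖a‖ : ℝ) * w‖ ≤ ‖a‖ + (1 - ‖a‖) * ‖w‖ := by
          refine (norm_add_le _ _).trans_eq ?_
          rw [norm_mul, Complex.norm_real, Real.norm_of_nonneg hs.le]
      _ < 1 := by nlinarith
  have h1 := norm_deriv_zero_le_of_omits_zero_one
    (hf.comp (g := f) (f := fun w : ℂ ↦ a + (1 - ‖a‖ : ℝ) * w) (by fun_prop) hmaps)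
    fun w hw ↦ h01 _ (hmaps hw)
  have hfa := (hf.differentiableAt (isOpen_ball.mem_nhds (mem_ball_zero_iff.2 ha))).hasDerivAt
  have hlin : HasDerivAt (fun w : ℂ ↦ a + (1 - ‖a‖ : ℝ) * w) ((1 - ‖a‖ : ℝ) : ℂ) 0 := by
    simpa using ((hasDerivAt_id (0 : ℂ)).const_mul ((1 - ‖a‖ : ℝ) : ℂ)).const_add a
  have hcomp := HasDerivAt.comp (h₂ := f) (h₂' := deriv f a) (0 : ℂ) (by rwa [mul_zero, add_zero]) hlin
  rw [hcomp.deriv, norm_mul, Complex.norm_real, Real.norm_of_nonneg hs.le] at h1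
  simpa using h1

/-- Differentiate ‖φ‖² in two ways and apply Cauchy–Schwarz. -/
theorem HasDerivAt.norm_of_ne_zero {E : Type*} [NormedAddCommGroup E] [InnerProductSpace ℝ E]
    {φ : ℝ → E} {φ' : E} {t : ℝ} (h : HasDerivAt φ φ' t) (h0 : φ t ≠ 0) :
    ∃ d : ℝ, HasDerivAt (fun s ↦ ‖φ s‖) d t ∧ |d| ≤ ‖φ'‖ := by
  have hd := (h.differentiableAt.norm ℝ h0).hasDerivAt
  refine ⟨_, hd, ?_⟩
  have heq := (hd.pow 2).unique h.norm_sq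
  have hpos : 0 < ‖φ t‖ := norm_pos_iff.2 h0
  have hinner := abs_real_inner_le_norm (φ t) φ'
  have h2 : ‖φ t‖ * _root_.deriv (fun s ↦ ‖φ s‖) t = Inner.inner ℝ (φ t) φ' := by
    norm_num at heq
    linarith
  rw [← h2, abs_mul, abs_norm] at hinner
  exact le_of_mul_le_mul_left hinner hpos

/-- The spherical Lipschitz estimate along radii. -/
theorem arctan_norm_le_of_omits_zero_one {f : ℂ → ℂ} (hf : DifferentiableOn ℂ f (ball 0 1))
    (h01 : ∀ z ∈ ball (0 : ℂ) 1, f z ≠ 0 ∧ f z ≠ 1) {z : ℂ} (hz : ‖z‖ < 1) :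
    Real.arctan ‖f z‖ ≤ Real.arctan ‖f 0‖ + 2 * 3840 * (‖z‖ / (1 - ‖z‖ ^ 2)) := by
  set ρ := ‖z‖ with hρ
  have hρ0 : 0 ≤ ρ := norm_nonneg z
  have hlt : ∀ t ∈ Icc (0 : ℝ) 1, t * ρ < 1 := fun t ht ↦ by nlinarith [ht.1, ht.2]
  have hnorm : ∀ t ∈ Icc (0 : ℝ) 1, ‖(t : ℂ) * z‖ = t * ρ := fun t ht ↦ by
    rw [norm_mul, Complex.norm_real, Real.norm_of_nonneg ht.1]
  have hmem : ∀ t ∈ Icc (0 : ℝ) 1, (t : ℂ) * z ∈ ball (0 : ℂ) 1 := fun t ht ↦ by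
    rw [mem_ball_zero_iff, hnorm t ht]
    exact hlt t ht
  have hder : ∀ t ∈ Icc (0 : ℝ) 1, ∃ d, HasDerivAt (fun s : ℝ ↦ Real.arctan ‖f (s * z)‖) d t ∧
      ‖d‖ ≤ 3840 * ρ / (1 - t * ρ) := by
    intro t ht
    have hfd := (hf.differentiableAt (isOpen_ball.mem_nhds (hmem t ht))).hasDerivAt
    have hlin : HasDerivAt (fun s : ℝ ↦ (s : ℂ) * z) z t := by
      simpa using (hasDerivAt_id t).ofReal_comp.mul_const z
    obtain ⟨d, hd, hdle⟩ :=
      (HasDerivAt.comp (h₂ := f) t hfd hlin).norm_of_ne_zero (h01 _ (hmem t ht)).1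
    refine ⟨_, hd.arctan, ?_⟩
    have hbound := norm_deriv_le_of_omits_zero_one hf h01 (a := t * z)
      (by rw [hnorm t ht]; exact hlt t ht)
    rw [hnorm t ht] at hbound
    have h1 : 0 < 1 - t * ρ := sub_pos.2 (hlt t ht)
    have h2 : 0 < 1 + ‖f (t * z)‖ ^ 2 := by positivity
    rw [norm_mul, ← hρ] at hdle
    simp only [Function.comp_apply]
    rw [norm_mul, Real.norm_of_nonneg (by positivity), Real.norm_eq_abs, one_div_mul_eq_div,
      div_le_div_iff₀ h2 h1]
    calc |d| * (1 - t * ρ) ≤ ‖deriv f (t * z)‖ * ρ * (1 - t * ρ) := by gcongr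
      _ = ‖deriv f (t * z)‖ * (1 - t * ρ) * ρ := by ring
      _ ≤ 3840 * (1 + ‖f (t * z)‖ ^ 2) * ρ := by gcongr
      _ = 3840 * ρ * (1 + ‖f (t * z)‖ ^ 2) := by ring
  choose! d hd hdle using hder
  -- The exact integral would be a logarithm; the comparison function u/(1 - u²), u = tρ, grows at
  -- least as fast because (1 - u)(1 + u)² ≤ 2(1 + u²).
  have hB : ∀ t ∈ Icc (0 : ℝ) 1,
      HasDerivAt (fun s ↦ Real.arctan ‖f 0‖ + 2 * 3840 * (s * ρ / (1 - (s * ρ) ^ 2)))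
        (2 * 3840 * (ρ * (1 + (t * ρ) ^ 2) / (1 - (t * ρ) ^ 2) ^ 2)) t := by
    intro t ht
    have h1 : 0 ≤ t * ρ := mul_nonneg ht.1 hρ0
    have h2 : 1 - (t * ρ) ^ 2 ≠ 0 := by nlinarith [hlt t ht]
    have hlin : HasDerivAt (fun s ↦ s * ρ) ρ t := by
      simpa using (hasDerivAt_id t).mul_const ρ
    refine (((hlin.div ((hlin.pow 2).const_sub 1) h2).const_mul (2 * 3840)).const_add
      (Real.arctan ‖f 0‖)).congr_deriv ?_
    norm_num
    ring
  have key := image_norm_le_of_norm_deriv_right_le_deriv_boundary'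
    (fun t ht ↦ (hd t ht).continuousAt.continuousWithinAt)
    (fun t ht ↦ (hd t (Ico_subset_Icc_self ht)).hasDerivWithinAt)
    (by simp [abs_of_nonneg (Real.arctan_nonneg.2 (norm_nonneg (f 0)))])
    (fun t ht ↦ (hB t ht).continuousAt.continuousWithinAt)
    (fun t ht ↦ (hB t (Ico_subset_Icc_self ht)).hasDerivWithinAt)
    (fun t ht ↦ by
      refine (hdle t (Ico_subset_Icc_self ht)).trans ?_
      have h1 : 0 ≤ t * ρ := mul_nonneg ht.1 hρ0
      have h2 : 0 < 1 - t * ρ := sub_pos.2 (hlt t (Ico_subset_Icc_self ht))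
      generalize t * ρ = u at h1 h2
      have h3 : 1 - u ^ 2 = (1 - u) * (1 + u) := by ring
      have h4 : 2 * 3840 * (ρ * (1 + u ^ 2) / (1 - u ^ 2) ^ 2) - 3840 * ρ / (1 - u) =
          3840 * ρ * (2 * (1 + u ^ 2) - (1 - u) * (1 + u) ^ 2) / (1 - u ^ 2) ^ 2 := by
        rw [h3]
        field_simp
      have h5 : 0 ≤ 2 * (1 + u ^ 2) - (1 - u) * (1 + u) ^ 2 := by
        nlinarith [mul_nonneg h1 h1, mul_nonneg (mul_nonneg h1 h1) h1, sq_nonneg (u - 1 / 2)]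
      have h6 : 0 ≤ 3840 * ρ * (2 * (1 + u ^ 2) - (1 - u) * (1 + u) ^ 2) / (1 - u ^ 2) ^ 2 := by
        positivity
      linarith)
    (right_mem_Icc.2 zero_le_one)
  simpa [abs_of_nonneg (Real.arctan_nonneg.2 (norm_nonneg (f z)))] using key

theorem mainTheorem2 :
    ∃ L : ℝ, 0 ≤ L ∧
      ∀ (f : ℂ → ℂ), DifferentiableOn ℂ f (Metric.ball 0 1) →
        (∀ z ∈ Metric.ball (0 : ℂ) 1, f z ≠ 0 ∧ f z ≠ 1) →
        ∀ M : ℝ, ‖f 0‖ < M →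
          ∀ r : ℝ, 0 < r → r < 1 →
            ∀ z : ℂ, ‖z‖ < r →
              Real.arctan ‖f z‖ < Real.arctan M + 2 * r * L / (1 - r ^ 2) ∧
              (Real.arctan M + 2 * r * L / (1 - r ^ 2) < Real.pi / 2 →
                ‖f z‖ < Real.tan (Real.arctan M + 2 * r * L / (1 - r ^ 2))) := by
  refine ⟨3840, by norm_num, fun f hf h01 M hM r hr0 hr1 z hz ↦ ?_⟩
  have hr2 : 0 < 1 - r ^ 2 := by nlinarith
  have h1 := arctan_norm_le_of_omits_zero_one hf h01 (hz.trans hr1)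
  -- Monotonicity in the radius suffices here; the strict inequality comes from |f(0)| < M.
  have h2 : ‖z‖ / (1 - ‖z‖ ^ 2) ≤ r / (1 - r ^ 2) := by gcongr
  have h3 : 2 * r * 3840 / (1 - r ^ 2) = 2 * 3840 * (r / (1 - r ^ 2)) := by ring
  have hlt : Real.arctan ‖f z‖ < Real.arctan M + 2 * r * 3840 / (1 - r ^ 2) := by
    rw [h3]
    linarith [Real.arctan_strictMono hM]
  refine ⟨hlt, fun hpi ↦ ?_⟩
  have := Real.tan_lt_tan_of_lt_of_lt_pi_div_two (Real.neg_pi_div_two_lt_arctan _) hpi hlt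
  rwa [Real.tan_arctan] at this
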